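/- **Setting.** SmartOTPs without partitioning into subtrees has $N \ge 1$ one-time passwords (OTPs) of $S$ bits, arranged in $L = N/P$ hash chains of length $P \ge 1$, where $P \mid N$. The hash function $h$, with $S$-bit outputs, is a random oracle whose uses are separated by domain: $F_k(j) = h(k\,\|\,j)$ for a uniformly random secret seed $k$ of at least $S$ bits, the steps $h_1, \dots, h_P$ of the hash chains (the same step functions for all chains), and the inner nodes of the Merkle tree. Chain $j$ is $x_0^j = F_k(j)$, $x_s^j = h_s(x_{s-1}^j)$ for $1 \le s \le P$. The values $x_P^j$ ($0 \le j < L$) are the leaves of the Merkle tree, and $x_{P-1-\ell}^j$ is the OTP of chain $j$ in the iteration layer $\ell$, $0 \le \ell < P$ (layers are counted in the order of their use). An adversary $\mathcal A$, computationally unbounded and randomized, is given all nodes of the Merkle tree and makes at most $Q$ adaptive queries to $h$; then it outputs $\ell$, $j$ and an $S$-bit string $z$, and it inverts the chain $j$ in layer $\ell$ if $z$ is a valid OTP there, that is, $h_P(\cdots h_{P-\ell}(z)\cdots) = x_P^j$. The scheme is broken if this happens for any $\ell$ and $j$; otherwise it is secure. **Claim.** For all $Q \ge 0$ and every such adversary,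 $$\Pr[\text{scheme is secure}] \;\ge\; 1 - \frac{L\,(2Q+2P+1)}{2^S}.$$ Moreover, to make the scheme as secure as a $\lambda$-bit random oracle, $\lambda \ge 0$ an integer, it is enough to set $S = \lambda + 2 + \log_2 L$ (or to take any larger integer $S$): for such $S$, all $Q\ge 0$ and every adversary with at most $Q$ queries, $$\Pr[\text{scheme is broken}] \;\le\; \frac{2Q+2P+1}{2^{\lambda+2}},$$ and for every $0 \le w < P$ the probability that the adversary outputs a valid OTP in one of the layers $0,\dots,w$ (whose check takes up to $w+1$ evaluations of $h$) is at most the probability with which some adversary with at most $\max(Q,w)$ queries inverts a $\lambda$-bit random oracle, i.e. finds, given $H(x)$ and oracle access to $H$, some $x'$ with $H(x') = H(x)$, where $H : \{0,1\}^\lambda \to \{0,1\}^\lambda$ and $x \in \{0,1\}^\lambda$ are uniformly random. In particular, the same number $Q$ of queries suffices for OTPs of the current layer ($w=0$), and for OTPs of all layers if $Q \ge P-1$. -/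

import Mathlib

namespace SmartOTP

/-- Bit strings of length `n`. -/
abbrev Word (n : ℕ) : Type := Fin n → Bool

/-! ### Oracle algorithms -/

/-- Deterministic algorithms that adaptively query an oracle `I → R` at most `n` times and then
output an element of `O`. -/
inductive QueryAlg (I R O : Type) : ℕ → Type
  | output {n : ℕ} (o : O) : QueryAlg I R O n
  | query {n : ℕ} (i : I) (next : R → QueryAlg I R O n) : QueryAlg I R O (n + 1)

/-- The output of an algorithm when its queries are answered by `H`. -/
def QueryAlg.run {I R O : Type} (H : I → R) : {n : ℕ} → QueryAlg I R O n → O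
  | _, .output o => o
  | _, .query i next => (next (H i)).run H

/-- Computationally unbounded randomized adversaries: after tossing coins (from any discrete
distribution) and reading an input from `V`, they make at most `q` adaptive oracle queries. -/
structure Adversary (V I R O : Type) (q : ℕ) where
  Coins : Type
  coinDist : PMF Coins
  strategy : Coins → V → QueryAlg I R O q

/-! ### Inverting a random oracle with inputs and outputs of `n` bits -/

/-- Adversaries making at most `q` queries that try to invert an `n`-bit random oracle. -/
abbrev ROInverter (n q : ℕ) : Type 1 := Adversary (Word n) (Word n) (Word n) (Word n) q

/-- A uniform function `H` on `n`-bit strings and a uniform string `x` are drawn, the inverter gets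
`H x` and oracle access to `H`, and the outcome is `true` iff it outputs a preimage of `H x`. -/
noncomputable def roExperiment {n q : ℕ} (B : ROInverter n q) : PMF Bool :=
  (PMF.uniformOfFintype (Word n)).bind fun x =>
    (PMF.uniformOfFintype (Word n → Word n)).bind fun H =>
      B.coinDist.map fun c => decide (H ((B.strategy c (H x)).run H) = H x)

/-- The probability that the inverter succeeds. -/
noncomputable def roProbInvert {n q : ℕ} (B : ROInverter n q) : ℝ :=
  (roExperiment B true).toReal

/-! ### The scheme

The parameters are the length `κ` of the secret seed, the length `S` of OTPs and hash values, the
chain length `P` and the number `L` of hash chains. The scheme provides `N = P * L` OTPs. -/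

/-- Inputs of the hash function `h` that the scheme uses, separated by domain:
seed and index (the pseudo-random function `F_k(j) = h(k ‖ j)`), the number of a step of the hash
chains and a hash value, and the values of the two children of a node of the Merkle tree. -/
abbrev HashInput (κ S P L : ℕ) : Type :=
  (Word κ × Fin L) ⊕ (Fin P × Word S) ⊕ (Word S × Word S)

instance (κ S P L : ℕ) : Fintype (HashInput κ S P L) := inferInstance

instance (κ S P L : ℕ) : DecidableEq (HashInput κ S P L) := inferInstance

/-- The hash function, modelled as a random oracle. -/
abbrev HashFun (κ S P L : ℕ) : Type := HashInput κ S P L → Word S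

section Scheme

variable {κ S P L : ℕ}

/-- `F_k(j)`, the first item of the `j`-th hash chain. -/
def prf (H : HashFun κ S P L) (k : Word κ) (j : Fin L) : Word S := H (Sum.inl (k, j))

/-- Step number `s` of a hash chain, `0 ≤ s < P` (only these `s` are used). -/
def chainStep (H : HashFun κ S P L) (s : ℕ) (x : Word S) : Word S :=
  if hs : s < P then H (Sum.inr (Sum.inl (⟨s, hs⟩, x))) else x

/-- The steps number `a, a + 1, …, a + n - 1` of a hash chain, applied one after the other. -/
def chainSteps (H : HashFun κ S P L) (a : ℕ) : ℕ → Word S → Word S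
  | 0, x => x
  | n + 1, x => chainStep H (a + n) (chainSteps H a n x)

/-- The OTP of the operation number `ℓ * L + j`, which is the OTP of the `j`-th chain in the
iteration layer number `ℓ` (layers are counted from `0` in the order of their use, so that the
first items of the chains form the last layer, number `P - 1`). -/
def getOTP (H : HashFun κ S P L) (k : Word κ) (ℓ : Fin P) (j : Fin L) : Word S :=
  chainSteps H 0 (P - 1 - ℓ) (prf H k j)

/-- The `j`-th leaf of the Merkle tree: the last value of the `j`-th hash chain, which is the hash
of its OTP in the first iteration layer. -/
def leaf (H : HashFun κ S P L) (k : Word κ) (j : Fin L) : Word S :=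
  chainSteps H 0 P (prf H k j)

/-- The `i`-th node of the Merkle tree on height `d` over the leaves. If `L` is not a power of two,
missing leaves are filled up by zero strings. -/
def merkleNode (H : HashFun κ S P L) (k : Word κ) : ℕ → ℕ → Word S
  | 0, i => if hi : i < L then leaf H k ⟨i, hi⟩ else fun _ => false
  | d + 1, i => H (Sum.inr (Sum.inr (merkleNode H k d (2 * i), merkleNode H k d (2 * i + 1))))

/-- A string `z` is valid as the OTP of chain `j` in layer `ℓ` if the smart contract, resolving the
hash chain from `z`, arrives at the `j`-th leaf. -/
def Valid (H : HashFun κ S P L) (k : Word κ) (ℓ : Fin P) (j : Fin L) (z : Word S) : Prop :=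
  chainSteps H (P - 1 - ℓ) (ℓ + 1) z = leaf H k j

end Scheme

/-- Adversaries against the scheme: they get all nodes of the Merkle tree (in particular the leaves
and the root), make at most `Q` queries to `h`, and output a layer, a chain and a string. -/
abbrev Attacker (κ S P L Q : ℕ) : Type 1 :=
  Adversary (ℕ → ℕ → Word S) (HashInput κ S P L) (Word S) (Fin P × Fin L × Word S) Q

/-- `h` and the seed are drawn uniformly at random; the outcome is `true` iff the adversary inverts
a chain, that is, outputs a valid OTP, in one of the layers number `0, …, w`. -/
noncomputable def attackExperiment {κ S P L Q : ℕ} (w : ℕ) (A : Attacker κ S P L Q) : PMF Bool :=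
  (PMF.uniformOfFintype (Word κ)).bind fun k =>
    (PMF.uniformOfFintype (HashFun κ S P L)).bind fun H =>
      A.coinDist.map fun c =>
        open Classical in
        let o := (A.strategy c (merkleNode H k)).run H
        decide ((o.1 : ℕ) ≤ w ∧ Valid H k o.1 o.2.1 o.2.2)

/-- The probability that the adversary outputs a valid OTP in one of the layers `0, …, w`. -/
noncomputable def probBreakUpTo {κ S P L Q : ℕ} (w : ℕ) (A : Attacker κ S P L Q) : ℝ :=
  (attackExperiment w A true).toReal

/-- The probability that the adversary breaks the scheme, by a valid OTP in any layer. -/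
noncomputable def probBreak {κ S P L Q : ℕ} (A : Attacker κ S P L Q) : ℝ :=
  (attackExperiment (P - 1) A true).toReal

/-- The probability that the scheme stays secure against the adversary. -/
noncomputable def probSecure {κ S P L Q : ℕ} (A : Attacker κ S P L Q) : ℝ :=
  (attackExperiment (P - 1) A false).toReal

end SmartOTP

/-! Let the attack be followed by the check of its output, at most `w + 1` further queries. A
success then forces a query to a chain step that is answered by a leaf (`Breaks.exists_query`). Take
independent uniform `G` and `F`, and use `G` on the inputs of the chains it generates and `F`
elsewhere. The result is again uniform (`card_mix`), since this set of inputs is determined by the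
values on it. If the run against `F` alone avoids these inputs, both runs coincide, so a success
needs one of two events (`Breaks.bad_query`). A query hits a chain input: apart from the leaves, the
run does not depend on the seed and `G`. Shifting the seed and all chain values before the leaves
preserves the leaves, so each query hits with probability at most `L / 2 ^ S`
(`card_query_chainPoints_le`). A chain query to `F` is answered by a leaf: the leaves do not depend
on `F`, so this again costs at most `L / 2 ^ S` per query (`card_query_leaf_le`). Together this
gives `2 * L * (Q + w + 1) / 2 ^ S`. For the comparison, exhaustive search with `q` queries and a
final guess inverts an `n`-bit oracle with probability at least `min 1 ((q + 1) / 2 ^ n)`. -/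

namespace SmartOTP

/-! ### Counting with resampled functions -/

section Counting

variable {I R : Type}

open Classical in
/-- The function that agrees with `G` on `C` and with `F` elsewhere. -/
noncomputable def mix (C : Set I) (G F : I → R) : I → R := fun i => if i ∈ C then G i else F i

theorem mix_of_mem {C : Set I} {i : I} (h : i ∈ C) (G F : I → R) : mix C G F i = G i := if_pos h

theorem mix_of_notMem {C : Set I} {i : I} (h : i ∉ C) (G F : I → R) : mix C G F i = F i :=
  if_neg h

theorem mix_mix_self (C : Set I) (G F : I → R) : mix C (mix C G F) (mix C F G) = G := by
  funext i
  by_cases h : i ∈ C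
  · simp only [mix_of_mem h]
  · simp only [mix_of_notMem h]

variable [Fintype I] [DecidableEq I] [Fintype R]

open Classical in
/-- If `C (mix (C G) G F) = C G`, then `mix (C G) G F` is uniform for uniform `G` and `F`. -/
theorem card_mix (C : (I → R) → Set I) (hC : ∀ G F, C (mix (C G) G F) = C G)
    (E : (I → R) → Prop) :
    Fintype.card (I → R) * (Finset.univ.filter E).card =
      (Finset.univ.filter fun p : (I → R) × (I → R) => E (mix (C p.1) p.1 p.2)).card := by
  -- The map swaps `G` and `F` outside `C G`; it is its own inverse because `C G` survives the swap.
  have hinv : Function.Involutive fun p : (I → R) × (I → R) =>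
      (mix (C p.1) p.1 p.2, mix (C p.1) p.2 p.1) := by
    rintro ⟨G, F⟩
    simp only [hC, mix_mix_self]
  have h1 : (Finset.univ.filter fun p : (I → R) × (I → R) => E (mix (C p.1) p.1 p.2)).card =
      (Finset.univ.filter fun p : (I → R) × (I → R) => E p.1).card := by
    refine Finset.card_bij (fun p _ => (mix (C p.1) p.1 p.2, mix (C p.1) p.2 p.1)) ?_ ?_ ?_
    · intro p hp
      simpa using hp
    · intro p _ p' _ h
      exact hinv.injective h
    · intro p hp
      refine ⟨_, ?_, hinv p⟩
      have := hinv p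
      simp only [Prod.ext_iff] at this
      simp only [Finset.mem_filter, Finset.mem_univ, true_and] at hp ⊢
      rw [this.1]
      exact hp
  have h2 : (Finset.univ.filter fun p : (I → R) × (I → R) => E p.1) =
      (Finset.univ.filter E) ×ˢ Finset.univ := by
    ext p
    simp
  rw [h1, h2, Finset.card_product, Finset.card_univ, mul_comm]

open Classical in
/-- Resampling the value of a uniform function at one point. -/
theorem card_update (i : I) (E : (I → R) → Prop) :
    Fintype.card R * (Finset.univ.filter E).card =
      ∑ r : R, (Finset.univ.filter fun F : I → R => E (Function.update F i r)).card := by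
  have hinv : Function.Involutive fun p : R × (I → R) => (p.2 i, Function.update p.2 i p.1) := by
    rintro ⟨r, F⟩
    simp
  have h1 : (Finset.univ.filter fun p : R × (I → R) => E (Function.update p.2 i p.1)).card =
      (Finset.univ.filter fun p : R × (I → R) => E p.2).card := by
    refine Finset.card_bij (fun p _ => (p.2 i, Function.update p.2 i p.1)) ?_ ?_ ?_
    · intro p hp
      simpa using hp
    · intro p _ p' _ h
      exact hinv.injective h
    · intro p hp
      refine ⟨_, ?_, hinv p⟩
      simpa using hp
  have h2 : (Finset.univ.filter fun p : R × (I → R) => E p.2) =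
      Finset.univ ×ˢ (Finset.univ.filter E) := by
    ext p
    simp
  rw [← Finset.card_univ, ← Finset.card_product, ← h2, ← h1]
  simp only [Finset.card_filter, Fintype.sum_prod_type]

open Classical in
/-- Averaging the probability of an event over a family of bijections. -/
theorem card_average {α Γ : Type} [Fintype α] [Fintype Γ] (T : Γ → α → α)
    (hT : ∀ γ, Function.Bijective (T γ)) (E : α → Prop) (b : ℕ)
    (hb : ∀ a, (Finset.univ.filter fun γ => E (T γ a)).card ≤ b) :
    Fintype.card Γ * (Finset.univ.filter E).card ≤ Fintype.card α * b := by
  have h1 : ∀ γ, (Finset.univ.filter fun a => E (T γ a)).card = (Finset.univ.filter E).card := by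
    intro γ
    simp only [Finset.card_filter]
    exact (hT γ).sum_comp (fun a => if E a then 1 else 0)
  calc Fintype.card Γ * (Finset.univ.filter E).card
      = ∑ γ : Γ, (Finset.univ.filter fun a => E (T γ a)).card := by
        simp [h1]
    _ = ∑ a : α, (Finset.univ.filter fun γ => E (T γ a)).card := by
        simp only [Finset.card_filter]
        exact Finset.sum_comm
    _ ≤ ∑ _a : α, b := Finset.sum_le_sum fun a _ => hb a
    _ = Fintype.card α * b := by simp

end Counting

/-! ### The queries of an algorithm -/

namespace QueryAlg

variable {I R O O' : Type}

/-- The list of queries that an algorithm makes when they are answered by `H`. -/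
def queries (H : I → R) : {n : ℕ} → QueryAlg I R O n → List I
  | _, .output _ => []
  | _, .query i next => i :: (next (H i)).queries H

/-- Some query and its answer satisfy `Bad`. -/
def HasQuery (H : I → R) {n : ℕ} (A : QueryAlg I R O n) (Bad : I → R → Prop) : Prop :=
  ∃ q ∈ A.queries H, Bad q (H q)

theorem hasQuery_query (H : I → R) {n : ℕ} (i : I) (next : R → QueryAlg I R O n)
    (Bad : I → R → Prop) : (QueryAlg.query i next).HasQuery H Bad ↔
      Bad i (H i) ∨ (next (H i)).HasQuery H Bad := by
  simp [HasQuery, queries]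

theorem length_queries_le (H : I → R) {n : ℕ} (A : QueryAlg I R O n) :
    (A.queries H).length ≤ n := by
  induction A with
  | output o => simp [queries]
  | query i next ih => simpa [queries] using ih (H i)

/-- Agreement is needed only on the queries of one run: adaptivity cannot separate the runs before
an answer differs. -/
theorem queries_congr {H F : I → R} {n : ℕ} (A : QueryAlg I R O n)
    (h : ∀ q ∈ A.queries F, H q = F q) : A.queries H = A.queries F := by
  induction A with
  | output o => rfl
  | query i next ih =>
    simp only [queries, List.mem_cons, forall_eq_or_imp] at h ⊢
    rw [h.1, ih (F i) h.2]

/-- The same algorithm, with one more query allowed. -/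
def lift : {n : ℕ} → QueryAlg I R O n → QueryAlg I R O (n + 1)
  | _, .output o => .output o
  | _, .query i next => .query i fun r => (next r).lift

theorem queries_lift (H : I → R) {n : ℕ} (A : QueryAlg I R O n) :
    A.lift.queries H = A.queries H := by
  induction A with
  | output o => rfl
  | query i next ih => simp [lift, queries, ih]

/-- The same algorithm, with `n` more queries allowed. -/
def liftBy {m : ℕ} (A : QueryAlg I R O m) : (n : ℕ) → QueryAlg I R O (m + n)
  | 0 => A
  | n + 1 => (A.liftBy n).lift

theorem queries_liftBy (H : I → R) {m : ℕ} (A : QueryAlg I R O m) (n : ℕ) :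
    (A.liftBy n).queries H = A.queries H := by
  induction n with
  | zero => rfl
  | succ n ih => rw [liftBy, queries_lift, ih]

/-- Run an algorithm, then another one that depends on its output. -/
def bind {m : ℕ} (f : O → QueryAlg I R O' m) :
    {n : ℕ} → QueryAlg I R O n → QueryAlg I R O' (m + n)
  | n, .output o => (f o).liftBy n
  | _, .query i next => .query i fun r => (next r).bind f

theorem queries_bind (H : I → R) {m n : ℕ} (f : O → QueryAlg I R O' m) (A : QueryAlg I R O n) :
    (A.bind f).queries H = A.queries H ++ (f (A.run H)).queries H := by
  induction A with
  | output o => simp [bind, queries, run, queries_liftBy]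
  | query i next ih => simp [bind, queries, run, ih]

open Classical in
/-- An algorithm with `n` queries to a random function, of which a part is already fixed, gets an
answer that is bad for the query with probability at most `n * m / |R|`, if at most `m` answers to
each query are bad. -/
theorem card_hasQuery_le [Fintype I] [DecidableEq I] [Fintype R] (Bad : I → R → Prop) (m : ℕ)
    (hm : ∀ i, (Finset.univ.filter (Bad i)).card ≤ m) {n : ℕ} (A : QueryAlg I R O n)
    (C : Set I) (g : I → R) (hg : ∀ i ∈ C, ¬ Bad i (g i)) :
    Fintype.card R * (Finset.univ.filter fun F : I → R => A.HasQuery (mix C g F) Bad).card ≤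
      n * m * Fintype.card (I → R) := by
  induction A generalizing C g with
  | output o => simp [HasQuery, queries]
  | @query n i next ih =>
    by_cases hi : i ∈ C
    · have := ih (g i) C g hg
      simp only [hasQuery_query, mix_of_mem hi, hg i hi, false_or]
      refine this.trans ?_
      gcongr
      exact Nat.le_succ n
    · rcases Nat.eq_zero_or_pos (Fintype.card R) with h0 | hpos
      · simp [h0]
      refine Nat.le_of_mul_le_mul_left ?_ hpos
      -- The answer `r` at the fresh point `i` is exposed first and joins the fixed part. At most
      -- `m` answers are bad, each charged in full; for the others the fixed part stays free of bad
      -- answers.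
      rw [card_update i, Finset.mul_sum]
      have hmix : ∀ (F : I → R) r, mix C g (Function.update F i r) =
          mix (insert i C) (Function.update g i r) F := by
        intro F r
        funext x
        by_cases hx : x = i
        · subst hx
          simp [mix, hi]
        · simp [mix, hx]
      have key : ∀ r, Fintype.card R * (Finset.univ.filter fun F : I → R =>
          (QueryAlg.query i next).HasQuery (mix C g (Function.update F i r)) Bad).card ≤
          (if Bad i r then Fintype.card R * Fintype.card (I → R) else 0) +
            n * m * Fintype.card (I → R) := by
        intro r
        by_cases hr : Bad i r
        · rw [if_pos hr]
          refine le_trans ?_ (Nat.le_add_right _ _)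
          gcongr
          exact Finset.card_le_univ _
        · rw [if_neg hr, zero_add]
          have := ih r (insert i C) (Function.update g i r) ?_
          · refine le_trans (le_of_eq ?_) this
            congr 2
            ext F
            have hmi : mix (insert i C) (Function.update g i r) F i = r := by
              simp [mix]
            rw [Finset.mem_filter, Finset.mem_filter, hmix, hasQuery_query, hmi]
            simp only [hr, false_or]
          · intro x hx
            by_cases hxi : x = i
            · subst hxi
              simpa using hr
            · simpa [hxi] using hg x (hx.resolve_left hxi)
      refine (Finset.sum_le_sum fun r _ => key r).trans ?_
      rw [Finset.sum_add_distrib, ← Finset.sum_filter, Finset.sum_const, Finset.sum_const,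
        Finset.card_univ, smul_eq_mul, smul_eq_mul]
      calc _ ≤ m * (Fintype.card R * Fintype.card (I → R)) +
            Fintype.card R * (n * m * Fintype.card (I → R)) := by
            gcongr
            exact hm i
        _ = _ := by ring

end QueryAlg

/-! ### Hash chains -/

section Chains

variable {κ S P L : ℕ}

/-- The inputs on which the values of the hash chains with seed `k` depend. -/
def chainPoints (H : HashFun κ S P L) (k : Word κ) : Set (HashInput κ S P L) :=
  fun q => match q with
  | .inl p => p.1 = k
  | .inr (.inl p) => ∃ j, p.2 = chainSteps H 0 p.1 (prf H k j)
  | .inr (.inr _) => False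

theorem chainSteps_congr {H G : HashFun κ S P L} {k : Word κ}
    (h : ∀ q ∈ chainPoints G k, H q = G q) (j : Fin L) (n : ℕ) :
    chainSteps H 0 n (prf H k j) = chainSteps G 0 n (prf G k j) := by
  induction n with
  | zero => exact h (.inl (k, j)) rfl
  | succ n ih =>
    simp only [chainSteps, ih, zero_add]
    unfold chainStep
    split
    · exact h (.inr (.inl _)) ⟨j, rfl⟩
    · rfl

/-- This self-determination is what `card_mix` requires of the set `C G`. -/
theorem chainPoints_congr {H G : HashFun κ S P L} {k : Word κ}
    (h : ∀ q ∈ chainPoints G k, H q = G q) : chainPoints H k = chainPoints G k := by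
  ext q
  rcases q with p | p | p
  · exact Iff.rfl
  · change (∃ j, _) ↔ (∃ j, _)
    simp only [chainSteps_congr h]
  · exact Iff.rfl

theorem leaf_congr {H G : HashFun κ S P L} {k : Word κ}
    (h : ∀ q ∈ chainPoints G k, H q = G q) : leaf H k = leaf G k :=
  funext fun j => chainSteps_congr h j P

theorem chainSteps_succ_left (H : HashFun κ S P L) (a n : ℕ) (x : Word S) :
    chainSteps H a (n + 1) x = chainSteps H (a + 1) n (chainStep H a x) := by
  induction n with
  | zero => rfl
  | succ n ih => rw [chainSteps, ih, chainSteps, add_right_comm, add_assoc]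

/-- The queries of at most `n` steps of a hash chain, from step number `s` on. -/
def resolve : (n s : ℕ) → Word S → QueryAlg (HashInput κ S P L) (Word S) Unit n
  | 0, _, _ => .output ()
  | n + 1, s, z =>
    if hs : s < P then .query (.inr (.inl (⟨s, hs⟩, z))) fun y => resolve n (s + 1) y
    else .output ()

/-- The last of the `m + 1` steps is itself a query. The budget `n` may exceed `m + 1`, so that one
budget serves all layers up to `w`. -/
theorem exists_mem_queries_resolve (H : HashFun κ S P L) (m : ℕ) :
    ∀ (n s : ℕ) (z : Word S), m < n → s + (m + 1) ≤ P →
      ∃ p, .inr (.inl p) ∈ (resolve n s z).queries H ∧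
        H (.inr (.inl p)) = chainSteps H s (m + 1) z := by
  induction m with
  | zero =>
    intro n s z hn hs
    obtain ⟨n, rfl⟩ := Nat.exists_eq_succ_of_ne_zero (by omega : n ≠ 0)
    have hs' : s < P := by omega
    refine ⟨(⟨s, hs'⟩, z), ?_, ?_⟩
    · simp [resolve, hs', QueryAlg.queries]
    · simp [chainSteps, chainStep, hs']
  | succ m ih =>
    intro n s z hn hs
    obtain ⟨n, rfl⟩ := Nat.exists_eq_succ_of_ne_zero (by omega : n ≠ 0)
    have hs' : s < P := by omega
    obtain ⟨p, hp, hp'⟩ := ih n (s + 1) (H (.inr (.inl (⟨s, hs'⟩, z)))) (by omega) (by omega)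
    refine ⟨p, ?_, ?_⟩
    · simp [resolve, hs', QueryAlg.queries, hp]
    · rw [hp', chainSteps_succ_left H s (m + 1)]
      simp [chainStep, hs']

/-- The nodes of the Merkle tree over given leaves. -/
def treeOf (H : HashFun κ S P L) (v : Fin L → Word S) : ℕ → ℕ → Word S
  | 0, i => if hi : i < L then v ⟨i, hi⟩ else fun _ => false
  | d + 1, i => H (.inr (.inr (treeOf H v d (2 * i), treeOf H v d (2 * i + 1))))

/-- Separates the dependence through the leaves from that through the inner nodes, which are
resampled differently. -/
theorem merkleNode_eq_treeOf (H : HashFun κ S P L) (k : Word κ) :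
    merkleNode H k = treeOf H (leaf H k) := by
  funext d
  induction d with
  | zero => rfl
  | succ d ih =>
    funext i
    simp only [merkleNode, treeOf, ih]

theorem treeOf_congr {H F : HashFun κ S P L} (h : ∀ p, H (.inr (.inr p)) = F (.inr (.inr p)))
    (v : Fin L → Word S) : treeOf H v = treeOf F v := by
  funext d
  induction d with
  | zero => rfl
  | succ d ih =>
    funext i
    simp only [treeOf, ih, h]

/-! ### Shifting the seed and the secret values of the chains -/

/-- Bitwise exclusive or. -/
def wxor {n : ℕ} (a b : Word n) : Word n := fun i => a i ^^ b i

theorem wxor_wxor_cancel_right {n : ℕ} (a b : Word n) : wxor (wxor a b) b = a := by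
  funext i
  simp [wxor]

theorem wxor_wxor_cancel_left {n : ℕ} (a b : Word n) : wxor a (wxor a b) = b := by
  funext i
  simp [wxor]

/-- Shift the seed by `u` and all values of the chains, except for the last ones, by `t`. -/
def shift (γ : Word κ × Word S) (a : Word κ × HashFun κ S P L) : Word κ × HashFun κ S P L :=
  (wxor a.1 γ.1, fun q => match q with
    | .inl p => wxor (a.2 (.inl (wxor p.1 γ.1, p.2))) γ.2
    | .inr (.inl p) =>
      if (p.1 : ℕ) + 1 < P then wxor (a.2 (.inr (.inl (p.1, wxor p.2 γ.2)))) γ.2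
      else a.2 (.inr (.inl (p.1, wxor p.2 γ.2)))
    | .inr (.inr p) => a.2 (.inr (.inr p)))

theorem shift_involutive (γ : Word κ × Word S) :
    Function.Involutive (shift γ : Word κ × HashFun κ S P L → _) := by
  rintro ⟨k, G⟩
  refine Prod.ext (wxor_wxor_cancel_right _ _) ?_
  funext q
  rcases q with p | p | p
  · simp [shift, wxor_wxor_cancel_right]
  · by_cases h : (p.1 : ℕ) + 1 < P
    · simp [shift, wxor_wxor_cancel_right, h]
    · simp [shift, wxor_wxor_cancel_right, h]
  · rfl

theorem chainSteps_shift (γ : Word κ × Word S) (a : Word κ × HashFun κ S P L) (j : Fin L)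
    (n : ℕ) (hn : n < P) :
    chainSteps (shift γ a).2 0 n (prf (shift γ a).2 (shift γ a).1 j) =
      wxor (chainSteps a.2 0 n (prf a.2 a.1 j)) γ.2 := by
  induction n with
  | zero => simp [chainSteps, prf, shift, wxor_wxor_cancel_right]
  | succ n ih =>
    have hn' : n < P := by omega
    simp only [chainSteps, ih hn', zero_add, chainStep, hn', dif_pos]
    simp [shift, hn, wxor_wxor_cancel_right]

/-- The last step undoes the shift of its input without shifting its output. For `P = 0` the leaf
would itself be shifted. -/
theorem leaf_shift (hP : 0 < P) (γ : Word κ × Word S) (a : Word κ × HashFun κ S P L) :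
    leaf (shift γ a).2 (shift γ a).1 = leaf a.2 a.1 := by
  obtain ⟨n, rfl⟩ := Nat.exists_eq_succ_of_ne_zero hP.ne'
  funext j
  have hn : n < n + 1 := Nat.lt_succ_self n
  simp only [leaf, chainSteps, chainSteps_shift γ a j n hn, zero_add, chainStep, hn, dif_pos]
  simp [shift, wxor_wxor_cancel_right]

-- A seed input fixes the seed shift and leaves `2 ^ S ≤ 2 ^ κ` pairs. For a step input, each of the
-- `L` chains allows one value shift, with any of the `2 ^ κ` seed shifts.
open Classical in
theorem card_shift_mem_chainPoints_le (hκ : S ≤ κ) (hL : 0 < L) (a : Word κ × HashFun κ S P L)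
    (q : HashInput κ S P L) :
    (Finset.univ.filter fun γ : Word κ × Word S =>
      q ∈ chainPoints (shift γ a).2 (shift γ a).1).card ≤ L * 2 ^ κ := by
  rcases q with p | p | p
  · have : (Finset.univ.filter fun γ : Word κ × Word S =>
        .inl p ∈ chainPoints (shift γ a).2 (shift γ a).1) ⊆
        {wxor a.1 p.1} ×ˢ (Finset.univ : Finset (Word S)) := by
      intro γ hγ
      have h : p.1 = wxor a.1 γ.1 := (Finset.mem_filter.1 hγ).2
      simp [h, wxor_wxor_cancel_left]
    refine (Finset.card_le_card this).trans ?_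
    simp only [Finset.card_product, Finset.card_singleton, one_mul, Finset.card_univ,
      Fintype.card_fun, Fintype.card_bool, Fintype.card_fin]
    calc 2 ^ S ≤ 2 ^ κ := Nat.pow_le_pow_right (by norm_num) hκ
      _ ≤ L * 2 ^ κ := Nat.le_mul_of_pos_left _ hL
  · have : (Finset.univ.filter fun γ : Word κ × Word S =>
        .inr (.inl p) ∈ chainPoints (shift γ a).2 (shift γ a).1) ⊆
        (Finset.univ : Finset (Word κ)) ×ˢ (Finset.univ.image fun j : Fin L =>
          wxor (chainSteps a.2 0 p.1 (prf a.2 a.1 j)) p.2) := by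
      intro γ hγ
      obtain ⟨j, hj⟩ : ∃ j, p.2 = chainSteps (shift γ a).2 0 p.1 (prf _ (shift γ a).1 j) :=
        (Finset.mem_filter.1 hγ).2
      rw [chainSteps_shift γ a j _ p.1.2] at hj
      simp only [Finset.mem_product, Finset.mem_univ, true_and, Finset.mem_image]
      exact ⟨j, by rw [hj, wxor_wxor_cancel_left]⟩
    refine (Finset.card_le_card this).trans ?_
    rw [Finset.card_product, mul_comm]
    refine Nat.mul_le_mul (Finset.card_image_le.trans (by simp)) (by simp)
  · have : (Finset.univ.filter fun γ : Word κ × Word S =>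
        .inr (.inr p) ∈ chainPoints (shift γ a).2 (shift γ a).1) = ∅ :=
      Finset.filter_eq_empty_iff.2 fun γ _ h => h
    rw [this]
    simp

/-! ### Counting the successful attacks of a deterministic adversary -/

variable {Q : ℕ}

/-- The attack succeeds in one of the layers `0, …, w`. -/
def Breaks (w : ℕ)
    (σ : (ℕ → ℕ → Word S) → QueryAlg (HashInput κ S P L) (Word S) (Fin P × Fin L × Word S) Q)
    (k : Word κ) (H : HashFun κ S P L) : Prop :=
  (((σ (merkleNode H k)).run H).1 : ℕ) ≤ w ∧
    Valid H k ((σ (merkleNode H k)).run H).1 ((σ (merkleNode H k)).run H).2.1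
      ((σ (merkleNode H k)).run H).2.2

/-- The attack, followed by the check of its output. -/
def checked (w : ℕ)
    (σ : (ℕ → ℕ → Word S) → QueryAlg (HashInput κ S P L) (Word S) (Fin P × Fin L × Word S) Q)
    (tree : ℕ → ℕ → Word S) : QueryAlg (HashInput κ S P L) (Word S) Unit (w + 1 + Q) :=
  (σ tree).bind fun o => resolve (w + 1) (P - 1 - o.1) o.2.2

variable (w : ℕ)
  (σ : (ℕ → ℕ → Word S) → QueryAlg (HashInput κ S P L) (Word S) (Fin P × Fin L × Word S) Q)

theorem Breaks.exists_query {w : ℕ}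
    {σ : (ℕ → ℕ → Word S) → QueryAlg (HashInput κ S P L) (Word S) (Fin P × Fin L × Word S) Q}
    {k : Word κ} {H : HashFun κ S P L} (h : Breaks w σ k H) :
    ∃ p, .inr (.inl p) ∈ (checked w σ (treeOf H (leaf H k))).queries H ∧
      ∃ j, H (.inr (.inl p)) = leaf H k j := by
  obtain ⟨hw, hv⟩ := h
  rw [← merkleNode_eq_treeOf]
  set o := (σ (merkleNode H k)).run H with ho
  have hlt := o.1.2
  obtain ⟨p, hp, hp'⟩ := exists_mem_queries_resolve H o.1 (w + 1) (P - 1 - o.1) o.2.2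
    (by omega) (by omega)
  refine ⟨p, ?_, o.2.1, hp'.trans hv⟩
  rw [checked, QueryAlg.queries_bind, ← ho]
  exact List.mem_append_right _ hp

/-- The query `q` is to a step of a chain, and its answer `r` is a leaf. -/
def IsLeafQuery (v : Fin L → Word S) (q : HashInput κ S P L) (r : Word S) : Prop :=
  q ∈ Set.range (Sum.inr ∘ Sum.inl) ∧ ∃ j, r = v j

/-- Either the attack against a function with independently chosen values on the chains queries a
point of a chain, or one of its queries, to a step of a chain, is answered by a leaf. -/
theorem Breaks.bad_query {w : ℕ}
    {σ : (ℕ → ℕ → Word S) → QueryAlg (HashInput κ S P L) (Word S) (Fin P × Fin L × Word S) Q}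
    {k : Word κ} {G F : HashFun κ S P L} (h : Breaks w σ k (mix (chainPoints G k) G F)) :
    (checked w σ (treeOf F (leaf G k))).HasQuery F (fun q _ => q ∈ chainPoints G k) ∨
      (checked w σ (treeOf F (leaf G k))).HasQuery F (IsLeafQuery (leaf G k)) := by
  by_cases hq : ∃ q ∈ (checked w σ (treeOf F (leaf G k))).queries F, q ∈ chainPoints G k
  · exact Or.inl hq
  · push Not at hq
    right
    obtain ⟨p, hp, j, hj⟩ := h.exists_query
    -- The leaves come from `G`; the inner nodes, the queries and the answer to the leaf query come
    -- from `F`.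
    rw [leaf_congr fun q hq => mix_of_mem hq G F] at hp hj
    rw [treeOf_congr (F := F) fun p =>
      mix_of_notMem (C := chainPoints G k) (fun h : False => h) G F] at hp
    rw [QueryAlg.queries_congr _ fun q h => mix_of_notMem (hq q h) G F] at hp
    rw [mix_of_notMem (hq _ hp)] at hj
    exact ⟨_, hp, ⟨p, rfl⟩, j, hj⟩

-- With `F` fixed, the list of queries is constant along the shifts, and a union bound over its
-- entries applies.
open Classical in
theorem card_query_chainPoints_le (hP : 0 < P) (hκ : S ≤ κ) (hL : 0 < L)
    (F : HashFun κ S P L) :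
    2 ^ S * (Finset.univ.filter fun a : Word κ × HashFun κ S P L =>
      (checked w σ (treeOf F (leaf a.2 a.1))).HasQuery F fun q _ => q ∈ chainPoints a.2 a.1).card ≤
        (w + 1 + Q) * L * (2 ^ κ * Fintype.card (HashFun κ S P L)) := by
  have h := card_average (α := Word κ × HashFun κ S P L) shift
    (fun γ => (shift_involutive γ).bijective)
    (fun a => (checked w σ (treeOf F (leaf a.2 a.1))).HasQuery F fun q _ => q ∈ chainPoints a.2 a.1)
    ((w + 1 + Q) * (L * 2 ^ κ)) ?_
  · simp only [Fintype.card_prod, Fintype.card_fun (α := Fin _), Fintype.card_bool,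
      Fintype.card_fin] at h
    refine Nat.le_of_mul_le_mul_left (c := 2 ^ κ) ?_ (by positivity)
    rw [← mul_assoc]
    calc _ ≤ _ := h
      _ = _ := by ring
  · intro a
    simp only [leaf_shift hP, QueryAlg.HasQuery]
    set l := (checked w σ (treeOf F (leaf a.2 a.1))).queries F with hl
    have hlen : l.length ≤ w + 1 + Q := QueryAlg.length_queries_le _ _
    have hsub : (Finset.univ.filter fun γ : Word κ × Word S =>
        ∃ q ∈ l, q ∈ chainPoints (shift γ a).2 (shift γ a).1) ⊆
        l.toFinset.biUnion fun q => Finset.univ.filter fun γ : Word κ × Word S =>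
          q ∈ chainPoints (shift γ a).2 (shift γ a).1 := by
      intro γ hγ
      simpa using hγ
    calc _ ≤ _ := Finset.card_le_card hsub
      _ ≤ l.toFinset.card * (L * 2 ^ κ) :=
        Finset.card_biUnion_le_card_mul _ _ _
          fun q _ => card_shift_mem_chainPoints_le hκ hL a q
      _ ≤ _ := Nat.mul_le_mul_right _ ((List.toFinset_card_le l).trans hlen)

open Classical in
theorem card_query_leaf_le (v : Fin L → Word S) :
    2 ^ S * (Finset.univ.filter fun F : HashFun κ S P L =>
      (checked w σ (treeOf F v)).HasQuery F (IsLeafQuery v)).card ≤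
      (w + 1 + Q) * L * Fintype.card (HashFun κ S P L) := by
  let Bad : HashInput κ S P L → Word S → Prop := IsLeafQuery v
  let C : Set (HashInput κ S P L) := Set.range (Sum.inr ∘ Sum.inr)
  have hBad : ∀ q, (Finset.univ.filter (Bad q)).card ≤ L := by
    intro q
    have : Finset.univ.filter (Bad q) ⊆ Finset.univ.image v := by
      intro r hr
      obtain ⟨-, j, rfl⟩ := (Finset.mem_filter.1 hr).2
      simp
    exact (Finset.card_le_card this).trans (Finset.card_image_le.trans (by simp))
  -- The tree given to the attack depends on `F` through its inner nodes. Their inputs are fixed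
  -- first, by `g`; they are never bad, as `IsLeafQuery` admits only chain steps.
  have hmix := card_mix (fun _ => C) (fun _ _ => rfl) fun F : HashFun κ S P L =>
    (checked w σ (treeOf F v)).HasQuery F Bad
  have hpos : 0 < Fintype.card (HashFun κ S P L) := Fintype.card_pos
  have hg : ∀ g : HashFun κ S P L, 2 ^ S * (Finset.univ.filter fun F : HashFun κ S P L =>
      (checked w σ (treeOf (mix C g F) v)).HasQuery (mix C g F) Bad).card ≤
      (w + 1 + Q) * L * Fintype.card (HashFun κ S P L) := by
    intro g
    have ht : ∀ F, treeOf (mix C g F) v = treeOf g v := fun F =>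
      treeOf_congr (fun p => mix_of_mem (C := C) ⟨p, rfl⟩ g F) v
    have h := QueryAlg.card_hasQuery_le Bad L hBad (checked w σ (treeOf g v)) C g ?_
    · simp only [ht]
      simpa only [Fintype.card_fun (α := Fin _), Fintype.card_bool, Fintype.card_fin] using h
    · rintro _ ⟨p, rfl⟩ ⟨⟨p', hp'⟩, -⟩
      simp at hp'
  refine Nat.le_of_mul_le_mul_left (c := Fintype.card (HashFun κ S P L)) ?_ hpos
  rw [mul_left_comm, hmix, Finset.card_filter, Fintype.sum_prod_type, Finset.mul_sum]
  calc _ ≤ ∑ _g : HashFun κ S P L, (w + 1 + Q) * L * Fintype.card (HashFun κ S P L) := by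
        refine Finset.sum_le_sum fun g _ => ?_
        rw [← Finset.card_filter]
        exact hg g
    _ = _ := by simp

open Classical in
/-- The attack succeeds with probability at most `2 * L * (Q + w + 1) / 2 ^ S`. -/
theorem card_breaks_le (hP : 0 < P) (hκ : S ≤ κ) (hL : 0 < L) :
    2 ^ S * (Finset.univ.filter fun a : Word κ × HashFun κ S P L => Breaks w σ a.1 a.2).card ≤
      2 * ((w + 1 + Q) * L) * (2 ^ κ * Fintype.card (HashFun κ S P L)) := by
  set M := Fintype.card (HashFun κ S P L) with hM
  have hpos : 0 < M := Fintype.card_pos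
  let Ea : Word κ × HashFun κ S P L → HashFun κ S P L → Prop := fun a F =>
    (checked w σ (treeOf F (leaf a.2 a.1))).HasQuery F fun q _ => q ∈ chainPoints a.2 a.1
  let Eb : Word κ × HashFun κ S P L → HashFun κ S P L → Prop := fun a F =>
    (checked w σ (treeOf F (leaf a.2 a.1))).HasQuery F (IsLeafQuery (leaf a.2 a.1))
  -- The factor `M` counts the choices of the second function `F`.
  have h1 : M * (Finset.univ.filter fun a : Word κ × HashFun κ S P L => Breaks w σ a.1 a.2).card
      ≤ ∑ a : Word κ × HashFun κ S P L,
        ((Finset.univ.filter (Ea a)).card + (Finset.univ.filter (Eb a)).card) := by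
    rw [Finset.card_filter, Fintype.sum_prod_type, Fintype.sum_prod_type, Finset.mul_sum]
    refine Finset.sum_le_sum fun k _ => ?_
    rw [← Finset.card_filter, hM, card_mix (fun G => chainPoints G k)
      (fun G F => chainPoints_congr fun q hq => mix_of_mem hq G F), Finset.card_filter,
      Fintype.sum_prod_type]
    refine Finset.sum_le_sum fun G _ => ?_
    rw [← Finset.card_filter]
    refine le_trans (Finset.card_le_card ?_) (Finset.card_union_le _ _)
    intro F hF
    have := (Finset.mem_filter.1 hF).2.bad_query
    simpa [Ea, Eb] using this
  have ha : 2 ^ S * ∑ a : Word κ × HashFun κ S P L, (Finset.univ.filter (Ea a)).card ≤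
      M * ((w + 1 + Q) * L * (2 ^ κ * M)) := by
    have hcomm : ∑ a : Word κ × HashFun κ S P L, (Finset.univ.filter (Ea a)).card =
        ∑ F : HashFun κ S P L, (Finset.univ.filter fun a => Ea a F).card := by
      simp only [Finset.card_filter]
      exact Finset.sum_comm
    rw [hcomm, Finset.mul_sum]
    refine (Finset.sum_le_sum fun F _ =>
      card_query_chainPoints_le w σ hP hκ hL F).trans (le_of_eq ?_)
    rw [Finset.sum_const, Finset.card_univ, smul_eq_mul]
  have hb : 2 ^ S * ∑ a : Word κ × HashFun κ S P L, (Finset.univ.filter (Eb a)).card ≤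
      (2 ^ κ * M) * ((w + 1 + Q) * L * M) := by
    rw [Finset.mul_sum]
    refine (Finset.sum_le_sum fun a _ =>
      card_query_leaf_le w σ (leaf a.2 a.1)).trans (le_of_eq ?_)
    rw [Finset.sum_const, Finset.card_univ, smul_eq_mul, Fintype.card_prod]
    simp only [Fintype.card_fun (α := Fin _), Fintype.card_bool, Fintype.card_fin, ← hM]
  refine Nat.le_of_mul_le_mul_left (c := M) ?_ hpos
  calc _ = 2 ^ S * (M * (Finset.univ.filter
        fun a : Word κ × HashFun κ S P L => Breaks w σ a.1 a.2).card) := by ring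
    _ ≤ 2 ^ S * ∑ a : Word κ × HashFun κ S P L,
        ((Finset.univ.filter (Ea a)).card + (Finset.univ.filter (Eb a)).card) := by gcongr
    _ = _ := by rw [Finset.sum_add_distrib, mul_add]
    _ ≤ _ := add_le_add ha hb
    _ = _ := by ring

end Chains

/-! ### From counting to probabilities -/

-- The coins are independent of the oracle and can be drawn first, which reduces to counting for
-- deterministic strategies.
open Classical in
theorem uniform_bind_map_apply {α β γ : Type} [Fintype α] [Nonempty α] [Fintype β] [Nonempty β]
    (p : PMF γ) (E : γ → α × β → Prop) :
    ((PMF.uniformOfFintype α).bind fun a => (PMF.uniformOfFintype β).bind fun b =>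
      p.map fun c => decide (E c (a, b))) true =
      ∑' c, p c * (((Finset.univ.filter (E c)).card : ENNReal) /
        (Fintype.card α * Fintype.card β : ℕ)) := by
  have hcomm : ∀ a, ((PMF.uniformOfFintype β).bind fun b => p.map fun c => decide (E c (a, b))) =
      p.bind fun c => (PMF.uniformOfFintype β).bind fun b => PMF.pure (decide (E c (a, b))) :=
    fun a => PMF.bind_comm _ _ fun b c => PMF.pure (decide (E c (a, b)))
  simp only [hcomm]
  rw [PMF.bind_comm, PMF.bind_apply]
  refine tsum_congr fun c => ?_
  congr 1
  have h : ∀ a b, PMF.pure (decide (E c (a, b))) true = if E c (a, b) then 1 else 0 := by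
    intro a b
    by_cases hE : E c (a, b) <;> simp [hE]
  have hα : (Fintype.card α : ENNReal) ≠ 0 := by simp
  simp only [PMF.bind_apply, PMF.uniformOfFintype_apply, tsum_fintype, h,
    ← Finset.mul_sum]
  rw [← mul_assoc, ← Fintype.sum_prod_type (f := fun x => if E c x then (1 : ENNReal) else 0),
    Finset.sum_boole, mul_comm, ENNReal.div_eq_inv_mul, mul_comm, Nat.cast_mul,
    ENNReal.mul_inv (Or.inl hα) (Or.inl (by simp))]

theorem tsum_mul_le_of_le {γ : Type} (p : PMF γ) (f : γ → ENNReal) (b : ENNReal)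
    (h : ∀ c, f c ≤ b) : ∑' c, p c * f c ≤ b := by
  calc ∑' c, p c * f c ≤ ∑' c, p c * b := ENNReal.tsum_le_tsum fun c => mul_le_mul_right (h c) _
    _ = b := by rw [ENNReal.tsum_mul_right, p.tsum_coe, one_mul]

section

variable {κ S P L Q : ℕ}

open Classical in
theorem probBreakUpTo_le (hP : 0 < P) (hκ : S ≤ κ) (hL : 0 < L) (w : ℕ)
    (A : Attacker κ S P L Q) :
    probBreakUpTo w A ≤ 2 * (L : ℝ) * (Q + w + 1) / 2 ^ S := by
  refine ENNReal.toReal_le_of_le_ofReal (by positivity) ?_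
  have heq := uniform_bind_map_apply (α := Word κ) (β := HashFun κ S P L) A.coinDist
    fun c a => Breaks w (A.strategy c) a.1 a.2
  refine (Eq.trans ?_ heq).trans_le ?_
  · simp only [attackExperiment, Breaks]
    congr! 6
    exact funext fun c => decide_eq_decide.2 Iff.rfl
  refine tsum_mul_le_of_le _ _ _ fun c => ?_
  have h := card_breaks_le w (A.strategy c) hP hκ hL
  set n := (Finset.univ.filter
    fun a : Word κ × HashFun κ S P L => Breaks w (A.strategy c) a.1 a.2).card
  have hM : (0 : ℝ) < Fintype.card (HashFun κ S P L) := by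
    exact_mod_cast Fintype.card_pos
  have hw : Fintype.card (Word κ) = 2 ^ κ := by simp
  rw [hw, ← ENNReal.ofReal_natCast, ← ENNReal.ofReal_natCast,
    ← ENNReal.ofReal_div_of_pos (by push_cast; positivity)]
  refine ENNReal.ofReal_le_ofReal ?_
  rw [div_le_div_iff₀ (by push_cast; positivity) (by positivity)]
  have h' : ((2 ^ S * n : ℕ) : ℝ) ≤ _ := Nat.cast_le.2 h
  push_cast at h' ⊢
  linarith

theorem probSecure_eq (A : Attacker κ S P L Q) : probSecure A = 1 - probBreak A := by
  have h := (attackExperiment (P - 1) A).tsum_coe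
  rw [tsum_fintype, Fintype.sum_bool] at h
  have h' := congrArg ENNReal.toReal h
  rw [ENNReal.toReal_add (PMF.apply_ne_top _ _) (PMF.apply_ne_top _ _), ENNReal.toReal_one] at h'
  rw [probSecure, probBreak]
  linarith

end

/-! ### Inverting a random oracle by exhaustive search -/

/-- Query `l q, …, l 1` and output the first preimage of `y` among them, or else `l 0`. -/
def search {I R : Type} [DecidableEq R] (l : ℕ → I) (y : R) : (q : ℕ) → QueryAlg I R I q
  | 0 => .output (l 0)
  | q + 1 => .query (l (q + 1)) fun r => if r = y then .output (l (q + 1)) else search l y q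

theorem run_search {I R : Type} [DecidableEq R] (H : I → R) (l : ℕ → I) (y : R) (q i : ℕ)
    (hi : i ≤ q) (hy : H (l i) = y) : H ((search l y q).run H) = y := by
  induction q with
  | zero =>
    obtain rfl : i = 0 := by omega
    exact hy
  | succ q ih =>
    by_cases h : H (l (q + 1)) = y
    · simp [search, QueryAlg.run, h]
    · have : i ≠ q + 1 := by
        rintro rfl
        exact h hy
      simpa [search, QueryAlg.run, h] using ih (by omega)

/-- The `q` queried strings and the unqueried default `l 0` make `q + 1` candidates. Success is
certain, for every `H`, once `x` is among them. -/
theorem exists_roInverter (n q : ℕ) :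
    ∃ B : ROInverter n q, min 1 (((q : ℝ) + 1) / 2 ^ n) ≤ roProbInvert B := by
  classical
  have hcard : Fintype.card (Word n) = 2 ^ n := by simp
  let e : Fin (2 ^ n) ≃ Word n := (Fintype.equivFinOfCardEq hcard).symm
  let l : ℕ → Word n := fun i => e ⟨i % 2 ^ n, Nat.mod_lt _ (by positivity)⟩
  let X : Finset (Word n) := (Finset.range (min (q + 1) (2 ^ n))).image l
  have hX : X.card = min (q + 1) (2 ^ n) := by
    rw [Finset.card_image_of_injOn, Finset.card_range]
    intro i hi j hj hij
    simp only [Finset.coe_range, Set.mem_Iio, lt_min_iff] at hi hj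
    have := congrArg Fin.val (e.injective hij)
    simpa [Nat.mod_eq_of_lt hi.2, Nat.mod_eq_of_lt hj.2] using this
  let B : ROInverter n q := ⟨Unit, PMF.pure (), fun _ y => search l y q⟩
  refine ⟨B, ?_⟩
  have hval : roProbInvert B = (((Finset.univ.filter fun a : Word n × (Word n → Word n) =>
      a.2 ((search l (a.2 a.1) q).run a.2) = a.2 a.1).card : ENNReal) /
        (Fintype.card (Word n) * Fintype.card (Word n → Word n) : ℕ)).toReal := by
    refine congrArg ENNReal.toReal ?_
    refine Eq.trans ?_ ((uniform_bind_map_apply B.coinDist fun c (a : Word n × (Word n → Word n)) =>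
      a.2 ((B.strategy c (a.2 a.1)).run a.2) = a.2 a.1).trans ?_)
    · unfold roExperiment
      congr!
    · rw [tsum_fintype]
      simp [B]
  have hsub : X ×ˢ (Finset.univ : Finset (Word n → Word n)) ⊆
      Finset.univ.filter fun a : Word n × (Word n → Word n) =>
        a.2 ((search l (a.2 a.1) q).run a.2) = a.2 a.1 := by
    intro a ha
    obtain ⟨i, hi, hia⟩ := Finset.mem_image.1 (Finset.mem_product.1 ha).1
    have hi' := Finset.mem_range.1 hi
    refine Finset.mem_filter.2 ⟨Finset.mem_univ _, ?_⟩
    exact run_search a.2 l _ q i (by omega) (by rw [hia])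
  have hle := Finset.card_le_card hsub
  rw [Finset.card_product, hX, Finset.card_univ] at hle
  have hM : (0 : ℝ) < Fintype.card (Word n → Word n) := by exact_mod_cast Fintype.card_pos
  rw [hval, ENNReal.toReal_div, ENNReal.toReal_natCast, ENNReal.toReal_natCast, hcard]
  push_cast
  rw [le_div_iff₀ (by positivity)]
  have hle' : ((min (q + 1) (2 ^ n) * Fintype.card (Word n → Word n) : ℕ) : ℝ) ≤ _ :=
    Nat.cast_le.2 hle
  refine le_trans (le_of_eq ?_) hle'
  push_cast
  rw [← mul_assoc, min_mul_of_nonneg _ _ (by positivity), one_mul,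
    div_mul_cancel₀ _ (by positivity), min_comm]

/-! ### The choice of the OTP length -/

theorem two_pow_mul_le {lam S L : ℕ} (hL : 0 < L)
    (h : (lam : ℝ) + 2 + Real.logb 2 (L : ℝ) ≤ (S : ℝ)) : (2 : ℝ) ^ (lam + 2) * L ≤ 2 ^ S := by
  have hL' : (0 : ℝ) < L := by exact_mod_cast hL
  have h1 : (2 : ℝ) ^ ((lam : ℝ) + 2 + Real.logb 2 (L : ℝ)) ≤ 2 ^ (S : ℝ) :=
    Real.rpow_le_rpow_of_exponent_le (by norm_num) h
  rw [Real.rpow_add (by norm_num), Real.rpow_logb (by norm_num) (by norm_num) hL',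
    Real.rpow_natCast] at h1
  have h2 : (2 : ℝ) ^ ((lam : ℝ) + 2) = 2 ^ (lam + 2) := by
    exact_mod_cast Real.rpow_natCast 2 (lam + 2)
  rwa [h2] at h1

theorem probBreakUpTo_le_of_le {κ S P L Q lam : ℕ} (hP : 0 < P) (hκ : S ≤ κ) (hL : 0 < L)
    (h : (lam : ℝ) + 2 + Real.logb 2 (L : ℝ) ≤ (S : ℝ)) (w : ℕ) (A : Attacker κ S P L Q) :
    probBreakUpTo w A ≤ 2 * ((Q : ℝ) + w + 1) / 2 ^ (lam + 2) := by
  refine (probBreakUpTo_le hP hκ hL w A).trans ?_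
  rw [div_le_div_iff₀ (by positivity) (by positivity)]
  calc 2 * (L : ℝ) * (Q + w + 1) * 2 ^ (lam + 2)
      = 2 * ((Q : ℝ) + w + 1) * (2 ^ (lam + 2) * L) := by ring
    _ ≤ _ := by gcongr; exact two_pow_mul_le hL h

theorem probBreakUpTo_le_one {κ S P L Q : ℕ} (w : ℕ) (A : Attacker κ S P L Q) :
    probBreakUpTo w A ≤ 1 :=
  ENNReal.toReal_le_of_le_ofReal zero_le_one (by simpa using PMF.coe_le_one _ _)

end SmartOTP

theorem corollary1 (κ S N P L : ℕ) (hP : 0 < P) (hN : 0 < N) (hdvd : P ∣ N) (hL : L = N / P)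
    (hκ : S ≤ κ) :
    -- the lower bound on the probability that the scheme is secure
    (∀ (Q : ℕ) (A : SmartOTP.Attacker κ S P L Q),
      1 - (L : ℝ) * (2 * (Q : ℝ) + 2 * (P : ℝ) + 1) / 2 ^ S ≤ SmartOTP.probSecure A) ∧
    -- the choice of `S` that makes the scheme as secure as a random oracle of `lam` bits
    (∀ lam : ℕ, (lam : ℝ) + 2 + Real.logb 2 (L : ℝ) ≤ (S : ℝ) →
      (∀ (Q : ℕ) (A : SmartOTP.Attacker κ S P L Q),
        SmartOTP.probBreak A ≤ (2 * (Q : ℝ) + 2 * (P : ℝ) + 1) / 2 ^ (lam + 2)) ∧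
      (∀ (Q : ℕ) (A : SmartOTP.Attacker κ S P L Q) (w : ℕ), w < P →
        ∃ B : SmartOTP.ROInverter lam (max Q w),
          SmartOTP.probBreakUpTo w A ≤ SmartOTP.roProbInvert B)) := by
  have hL0 : 0 < L := hL ▸ Nat.div_pos (Nat.le_of_dvd hN hdvd) hP
  have hP1 : ((P - 1 : ℕ) : ℝ) = P - 1 := by
    rw [Nat.cast_sub hP, Nat.cast_one]
  refine ⟨fun Q A => ?_, fun lam hlam => ⟨fun Q A => ?_, fun Q A w _ => ?_⟩⟩
  · have h : SmartOTP.probBreak A ≤ _ := SmartOTP.probBreakUpTo_le hP hκ hL0 (P - 1) A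
    rw [hP1] at h
    rw [SmartOTP.probSecure_eq]
    refine sub_le_sub_left (h.trans ?_) 1
    refine div_le_div_of_nonneg_right ?_ (by positivity)
    nlinarith [(Nat.cast_nonneg L : (0 : ℝ) ≤ L)]
  · have h : SmartOTP.probBreak A ≤ _ :=
      SmartOTP.probBreakUpTo_le_of_le hP hκ hL0 hlam (P - 1) A
    rw [hP1] at h
    refine h.trans ?_
    refine div_le_div_of_nonneg_right ?_ (by positivity)
    linarith
  · obtain ⟨B, hB⟩ := SmartOTP.exists_roInverter lam (max Q w)
    refine ⟨B, le_trans (le_min (SmartOTP.probBreakUpTo_le_one w A) ?_) hB⟩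
    refine (SmartOTP.probBreakUpTo_le_of_le hP hκ hL0 hlam w A).trans ?_
    have hQ : (Q : ℝ) ≤ (max Q w : ℕ) := Nat.cast_le.2 (le_max_left _ _)
    have hw : (w : ℝ) ≤ (max Q w : ℕ) := Nat.cast_le.2 (le_max_right _ _)
    -- The claim reduces to `2 * (Q + w + 1) ≤ 4 * (max Q w + 1)`; the two extra bits of `S` supply
    -- the factor 4.
    rw [div_le_div_iff₀ (by positivity) (by positivity), pow_add]
    have : (0 : ℝ) < 2 ^ lam := by positivity
    nlinarith
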